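/- \textbf{Density Lemma.} Let $\Lambda\subseteq[0,\infty)$ be closed under addition with $0\in\Lambda$. Let $w\colon\Lambda\to(0,\infty)$ be an \emph{admissible weight function}, i.e. $w(0)=1$, $w(\lambda+\mu)\le w(\lambda)w(\mu)$ for all $\lambda,\mu\in\Lambda$, $w(\lambda)\ge 1$ for all $\lambda\in\Lambda$, and $\lim_{k\to\infty}w(k\lambda)^{1/k}=1$ for all $\lambda\in\Lambda$. Let $\mathscr A_w$ be the commutative unital Banach algebra of all $a\colon\Lambda\to\mathbb C$ with $\|a\|_w=\sum_{\lambda\in\Lambda}|a(\lambda)|\,w(\lambda)<\infty$, with pointwise linear operations and the convolution $(a*b)(\lambda)=\sum_{\lambda'+\lambda''=\lambda}a(\lambda')b(\lambda'')$ as multiplication; its unit is $\varepsilon(\lambda)=\delta_{0,\lambda}$. Let $\mathbb H=\{s\in\mathbb C:\operatorname{Re}s>0\}$, and for $a\in\mathscr A_w$ and $s\in\mathbb H$ put $\widetilde a(s)=\sum_{\lambda\in\Lambda}a(\lambda)e^{-\lambda s}$ (an absolutely convergent series). Let $\sigma(a)$ be the spectrum of $a$, i.e. the set of all $z\in\mathbb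 C$ such that $a-z\varepsilon$ is not invertible in $\mathscr A_w$. Then for every $a\in\mathscr A_w$ the set $\widetilde a(\mathbb H)$ is a dense subset of $\sigma(a)$, that is, $$\widetilde a(\mathbb H)\subseteq\sigma(a)\subseteq\overline{\widetilde a(\mathbb H)}.$$ Moreover, in terms of characters: for every $a\in\mathscr A_w$, every nontrivial multiplicative linear functional $h\colon\mathscr A_w\to\mathbb C$ and every $\epsilon>0$ there is $s\in\mathbb H$ with $|\widetilde a(s)-h(a)|<\epsilon$. -/

import Mathlib

open Filter Topology

/-- A weight function on a commutative additive monoid `M`: a function `w : M → (0, ∞)` with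
`w 0 = 1` and `w (x + y) ≤ w x * w y`. -/
structure WeightFn (M : Type*) [AddCommMonoid M] where
  toFun : M → ℝ
  pos' : ∀ x, 0 < toFun x
  map_zero' : toFun 0 = 1
  map_add_le' : ∀ x y, toFun (x + y) ≤ toFun x * toFun y

namespace WeightFn

variable {M : Type*} [AddCommMonoid M]

instance : CoeFun (WeightFn M) (fun _ => M → ℝ) := ⟨WeightFn.toFun⟩

/-- A weight `w` is admissible if `w ≥ 1` and `w (k x) ^ (1 / k) → 1` as `k → ∞`, for every `x`. -/
structure IsAdmissible (w : WeightFn M) : Prop where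
  one_le : ∀ x, 1 ≤ w x
  tendsto_root : ∀ x, Tendsto (fun k : ℕ => (w (k • x)) ^ (1 / (k : ℝ))) atTop (𝓝 1)

/-- The complex vector space of all `a : M → ℂ` with `∑ |a x| w x < ∞`. -/
def submodule (w : WeightFn M) : Submodule ℂ (M → ℂ) where
  carrier := {a | Summable fun x => ‖a x‖ * w x}
  zero_mem' := by simp [summable_zero]
  add_mem' := by
    intro a b ha hb
    refine Summable.of_nonneg_of_le (fun x => mul_nonneg (norm_nonneg _) (w.pos' x).le)
      (fun x => ?_) (Summable.add ha hb)
    rw [← add_mul]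
    exact mul_le_mul_of_nonneg_right (norm_add_le _ _) (w.pos' x).le
  smul_mem' := by
    intro c a ha
    have := Summable.mul_left ‖c‖ ha
    simpa [mul_assoc] using this

/-- The weighted semigroup algebra of `M` with weight `w`: all `a : M → ℂ` with
`∑ |a x| w x < ∞`, with pointwise linear operations and with convolution as multiplication. -/
def WeightedAlgebra (w : WeightFn M) : Type _ := w.submodule

end WeightFn

namespace WeightFn.WeightedAlgebra

variable {M : Type*} [AddCommMonoid M] {w : WeightFn M}

instance : AddCommGroup w.WeightedAlgebra := inferInstanceAs (AddCommGroup w.submodule)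

instance : Module ℂ w.WeightedAlgebra := inferInstanceAs (Module ℂ w.submodule)

/-- The underlying function of an element of the weighted algebra. -/
def coeff (a : w.WeightedAlgebra) : M → ℂ := Subtype.val (p := fun f => f ∈ w.submodule) a

instance : CoeFun w.WeightedAlgebra (fun _ => M → ℂ) := ⟨coeff⟩

@[ext] theorem ext {a b : w.WeightedAlgebra} (h : ∀ x, a x = b x) : a = b := Subtype.ext (funext h)

theorem summable (a : w.WeightedAlgebra) : Summable fun x => ‖a x‖ * w x := a.2

theorem add_apply (a b : w.WeightedAlgebra) (x : M) : (a + b) x = a x + b x := rfl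

theorem smul_apply (c : ℂ) (a : w.WeightedAlgebra) (x : M) : (c • a) x = c * a x := rfl

/-- The convolution `(a * b) z = ∑_{x + y = z} a x * b y`. -/
noncomputable def conv (a b : M → ℂ) (z : M) : ℂ :=
  ∑' p : {p : M × M // p.1 + p.2 = z}, a p.1.1 * b p.1.2

theorem summable_majorant (a b : w.WeightedAlgebra) :
    Summable fun p : M × M => (‖a p.1‖ * w p.1) * (‖b p.2‖ * w p.2) :=
  Summable.mul_of_nonneg a.summable b.summable
    (fun x => mul_nonneg (norm_nonneg _) (w.pos' x).le)
    (fun x => mul_nonneg (norm_nonneg _) (w.pos' x).le)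

theorem norm_term_le (a b : w.WeightedAlgebra) {g : M → ℂ} {C : ℝ} (hg : ∀ x, ‖g x‖ ≤ C * w x)
    (p : M × M) : ‖a p.1 * b p.2 * g (p.1 + p.2)‖ ≤
      C * ((‖a p.1‖ * w p.1) * (‖b p.2‖ * w p.2)) := by
  have hC : 0 ≤ C := by
    have h1 := (norm_nonneg _).trans (hg 0)
    rwa [w.map_zero', mul_one] at h1
  rw [norm_mul, norm_mul]
  calc ‖a p.1‖ * ‖b p.2‖ * ‖g (p.1 + p.2)‖
      ≤ ‖a p.1‖ * ‖b p.2‖ * (C * (w p.1 * w p.2)) := by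
        gcongr
        exact (hg _).trans (mul_le_mul_of_nonneg_left (w.map_add_le' _ _) hC)
    _ = _ := by ring

theorem summable_term (a b : w.WeightedAlgebra) {g : M → ℂ} {C : ℝ} (hg : ∀ x, ‖g x‖ ≤ C * w x) :
    Summable fun p : M × M => a p.1 * b p.2 * g (p.1 + p.2) :=
  Summable.of_norm_bounded ((summable_majorant a b).mul_left C) (norm_term_le a b hg)

/-- The families that define the convolution are summable. -/
theorem summable_conv (a b : w.WeightedAlgebra) (z : M) :
    Summable fun p : {p : M × M // p.1 + p.2 = z} => ‖a p.1.1 * b p.1.2‖ := by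
  refine Summable.of_nonneg_of_le (fun _ => norm_nonneg _) (fun p => ?_)
    (((summable_majorant a b).subtype {p | p.1 + p.2 = z}).mul_left (w z)⁻¹)
  have hz := w.pos' z
  have h := w.map_add_le' p.1.1 p.1.2
  rw [p.2] at h
  rw [norm_mul, le_inv_mul_iff₀ hz]
  calc w z * (‖a p.1.1‖ * ‖b p.1.2‖) ≤ (w p.1.1 * w p.1.2) * (‖a p.1.1‖ * ‖b p.1.2‖) := by gcongr
    _ = _ := by simp only [Function.comp]; ring

theorem conv_mem (a b : w.WeightedAlgebra) : Summable fun z => ‖conv a b z‖ * w z := by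
  have hs := (Equiv.sigmaFiberEquiv (fun p : M × M => p.1 + p.2)).summable_iff.mpr
    (summable_majorant a b)
  refine Summable.of_nonneg_of_le (fun z => mul_nonneg (norm_nonneg _) (w.pos' z).le)
    (fun z => ?_) hs.sigma
  have h1 := norm_tsum_le_tsum_norm (summable_conv a b z)
  calc ‖conv a b z‖ * w z
      ≤ (∑' p : {p : M × M // p.1 + p.2 = z}, ‖a p.1.1 * b p.1.2‖) * w z :=
        mul_le_mul_of_nonneg_right h1 (w.pos' z).le
    _ = ∑' p : {p : M × M // p.1 + p.2 = z}, ‖a p.1.1 * b p.1.2‖ * w z := tsum_mul_right.symm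
    _ ≤ _ := by
        refine Summable.tsum_le_tsum (fun p => ?_) ((summable_conv a b z).mul_right _)
          (hs.sigma_factor z)
        have h := w.map_add_le' p.1.1 p.1.2
        rw [p.2] at h
        rw [norm_mul]
        calc ‖a p.1.1‖ * ‖b p.1.2‖ * w z ≤ ‖a p.1.1‖ * ‖b p.1.2‖ * (w p.1.1 * w p.1.2) := by gcongr
          _ = _ := by simp only [Function.comp, Equiv.sigmaFiberEquiv, Equiv.coe_fn_mk]; ring

noncomputable instance : Mul w.WeightedAlgebra := ⟨fun a b => ⟨conv a b, conv_mem a b⟩⟩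

open Classical in
/-- The unit: the Kronecker delta at `0`. -/
noncomputable instance : One w.WeightedAlgebra :=
  ⟨⟨Pi.single 0 1, summable_of_ne_finset_zero (s := {0}) (by
    intro x hx
    rw [Finset.notMem_singleton] at hx
    simp [hx])⟩⟩

theorem mul_apply (a b : w.WeightedAlgebra) (z : M) :
    (a * b) z = ∑' p : {p : M × M // p.1 + p.2 = z}, a p.1.1 * b p.1.2 := rfl

open Classical in
theorem one_apply (z : M) : (1 : w.WeightedAlgebra) z = if z = 0 then 1 else 0 := by
  change (Pi.single 0 1 : M → ℂ) z = _
  simp [Pi.single_apply]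

theorem tsum_mul_apply (a b : w.WeightedAlgebra) {g : M → ℂ} {C : ℝ} (hg : ∀ x, ‖g x‖ ≤ C * w x) :
    ∑' z, (a * b) z * g z = ∑' x, ∑' y, a x * b y * g (x + y) := by
  have hs := summable_term a b hg
  have hs' := (Equiv.sigmaFiberEquiv (fun p : M × M => p.1 + p.2)).summable_iff.mpr hs
  have h1 := (Equiv.sigmaFiberEquiv (fun p : M × M => p.1 + p.2)).tsum_eq
    (fun p : M × M => a p.1 * b p.2 * g (p.1 + p.2))
  rw [← hs.tsum_prod, ← h1]
  refine Eq.trans ?_ hs'.tsum_sigma.symm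
  refine tsum_congr fun z => ?_
  rw [mul_apply, ← tsum_mul_right]
  refine tsum_congr fun p => ?_
  simp only [Function.comp, Equiv.sigmaFiberEquiv, Equiv.coe_fn_mk]
  rw [p.2]

open Classical in
theorem mul_apply_eq (a b : w.WeightedAlgebra) (z : M) :
    (a * b) z = ∑' x, ∑' y, a x * b y * (if x + y = z then 1 else 0) := by
  have hg : ∀ x, ‖(if x = z then (1 : ℂ) else 0)‖ ≤ (w z)⁻¹ * w x := by
    intro x
    have h1 := w.pos' x
    have h2 := w.pos' z
    split_ifs with h
    · subst h
      simp [h1.ne']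
    · rw [norm_zero]; positivity
  rw [← tsum_mul_apply a b hg, tsum_eq_single z (fun x hx => by simp [hx])]
  simp

open Classical in
theorem norm_shift_le (c : w.WeightedAlgebra) (z x : M) :
    ‖∑' y, c y * (if x + y = z then (1 : ℂ) else 0)‖ ≤
      ((w z)⁻¹ * ∑' y, ‖c y‖ * w y) * w x := by
  have hz := w.pos' z
  have hx := w.pos' x
  refine tsum_of_norm_bounded
    (((c.summable.hasSum).mul_left (w z)⁻¹).mul_right (w x)) fun y => ?_
  have hy := w.pos' y
  split_ifs with h
  · have h1 := w.map_add_le' x y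
    rw [h] at h1
    rw [mul_one, mul_assoc, le_inv_mul_iff₀ hz]
    calc w z * ‖c y‖ ≤ (w x * w y) * ‖c y‖ := by gcongr
      _ = _ := by ring
  · rw [mul_zero, norm_zero]; positivity

protected theorem mul_comm (a b : w.WeightedAlgebra) : a * b = b * a := by
  ext z
  rw [mul_apply, mul_apply]
  let e : {p : M × M // p.1 + p.2 = z} ≃ {p : M × M // p.1 + p.2 = z} :=
    (Equiv.prodComm M M).subtypeEquiv fun p => by simp [add_comm]
  rw [← e.tsum_eq]
  exact tsum_congr fun p => mul_comm _ _

open Classical in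
protected theorem mul_assoc (a b c : w.WeightedAlgebra) : a * b * c = a * (b * c) := by
  ext z
  rw [mul_apply_eq (a * b) c, mul_apply_eq a (b * c)]
  have h1 : ∀ x, ∑' y, (a * b) x * c y * (if x + y = z then (1 : ℂ) else 0) =
      (a * b) x * ∑' y, c y * (if x + y = z then (1 : ℂ) else 0) := by
    intro x
    simp only [mul_assoc, tsum_mul_left]
  simp only [h1]
  rw [tsum_mul_apply a b (norm_shift_le c z)]
  refine tsum_congr fun u => ?_
  simp only [mul_assoc, tsum_mul_left]
  congr 1
  have hg : ∀ x, ‖(if u + x = z then (1 : ℂ) else 0)‖ ≤ ((w z)⁻¹ * w u) * w x := by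
    intro x
    have hx := w.pos' x
    have hz := w.pos' z
    have hu := w.pos' u
    split_ifs with h
    · have h1 := w.map_add_le' u x
      rw [h] at h1
      rw [norm_one, mul_assoc, le_inv_mul_iff₀ hz, mul_one]
      exact h1
    · rw [norm_zero]; positivity
  rw [tsum_mul_apply b c hg]
  refine tsum_congr fun v => ?_
  simp only [mul_assoc, tsum_mul_left, add_assoc]

protected theorem left_distrib (a b c : w.WeightedAlgebra) : a * (b + c) = a * b + a * c := by
  ext z
  rw [add_apply, mul_apply, mul_apply, mul_apply,
    ← (summable_conv a b z).of_norm.tsum_add (summable_conv a c z).of_norm]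
  exact tsum_congr fun p => by rw [add_apply, mul_add]

open Classical in
protected theorem one_mul (a : w.WeightedAlgebra) : 1 * a = a := by
  ext z
  rw [mul_apply, tsum_eq_single ⟨(0, z), zero_add z⟩]
  · simp [one_apply]
  · rintro ⟨⟨x, y⟩, h⟩ hne
    have hx : x ≠ 0 := by
      rintro rfl
      apply hne
      simp only [zero_add] at h
      simp [h]
    simp [one_apply, hx]

protected theorem smul_mul (c : ℂ) (a b : w.WeightedAlgebra) : c • a * b = c • (a * b) := by
  ext z
  rw [smul_apply, mul_apply, mul_apply, ← tsum_mul_left]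
  exact tsum_congr fun p => by rw [smul_apply, mul_assoc]

protected theorem zero_mul (a : w.WeightedAlgebra) : 0 * a = 0 := by
  have h := WeightFn.WeightedAlgebra.smul_mul 0 0 a
  rwa [zero_smul, zero_smul] at h

noncomputable instance : CommRing w.WeightedAlgebra where
  __ := (inferInstance : AddCommGroup w.WeightedAlgebra)
  mul_assoc := WeightFn.WeightedAlgebra.mul_assoc
  mul_comm := WeightFn.WeightedAlgebra.mul_comm
  one_mul := WeightFn.WeightedAlgebra.one_mul
  mul_one a := by rw [WeightFn.WeightedAlgebra.mul_comm, WeightFn.WeightedAlgebra.one_mul]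
  left_distrib := WeightFn.WeightedAlgebra.left_distrib
  right_distrib a b c := by
    rw [WeightFn.WeightedAlgebra.mul_comm, WeightFn.WeightedAlgebra.left_distrib,
      WeightFn.WeightedAlgebra.mul_comm c a, WeightFn.WeightedAlgebra.mul_comm c b]
  zero_mul := WeightFn.WeightedAlgebra.zero_mul
  mul_zero a := by rw [WeightFn.WeightedAlgebra.mul_comm, WeightFn.WeightedAlgebra.zero_mul]

noncomputable instance : Algebra ℂ w.WeightedAlgebra :=
  Algebra.ofModule WeightFn.WeightedAlgebra.smul_mul fun c a b => by
    rw [mul_comm, WeightFn.WeightedAlgebra.smul_mul, mul_comm]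

end WeightFn.WeightedAlgebra

/-- The general Dirichlet series `∑ a(l) exp(-l s)`, summed over `l ∈ Λ`. -/
noncomputable def dirichletSeries {Λ : AddSubmonoid ℝ} (a : Λ → ℂ) (s : ℂ) : ℂ :=
  ∑' l : Λ, a l * Complex.exp (-((l : ℝ) : ℂ) * s)

/-- For admissible `w` and `Λ ⊆ [0, ∞)` the Dirichlet series of an element of the weighted algebra
converges absolutely on the closed right half plane. -/
theorem summable_dirichletSeries {Λ : AddSubmonoid ℝ} (hΛ : ∀ x ∈ Λ, 0 ≤ x) {w : WeightFn Λ}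
    (hw : w.IsAdmissible) (a : w.WeightedAlgebra) {s : ℂ} (hs : 0 ≤ s.re) :
    Summable fun l : Λ => ‖a l * Complex.exp (-((l : ℝ) : ℂ) * s)‖ := by
  refine Summable.of_nonneg_of_le (fun _ => norm_nonneg _) (fun l => ?_) a.summable
  rw [norm_mul, Complex.norm_exp]
  refine mul_le_mul_of_nonneg_left (le_trans ?_ (hw.one_le l)) (norm_nonneg _)
  rw [Real.exp_le_one_iff]
  have := mul_nonneg (hΛ l l.2) hs
  simpa using this

/-- The open right half plane. -/
def rightHalfPlane : Set ℂ := {s | 0 < s.re}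

/-!
For `s` in the open right half plane `ℍ`, evaluation of Dirichlet series at `s` is a character of the
weighted algebra, so its values lie in the spectrum. The weighted algebra is a Banach algebra, so
its spectra consist of character values, and everything reduces to the approximation of a character
value `h a` by values of the Dirichlet series of `a`. In general this cannot be done for several
elements with the same `s`: a character may vanish at some exponents and not at others. The
argument therefore works with the given element and avoids approximation of `h` on a finite set.

It rests on the inequality `‖h b‖ ≤ sup_ℍ ‖b̃‖` (`norm_algHom_le`), proved by Bohr's power trick.
A character is bounded by `1` on the basis elements, because `w (k l) ^ (1 / k) → 1`. Hence for
finitely supported `b` the value `‖h b‖ ^ k = ‖h (b ^ k)‖` is at most the `ℓ¹` norm of the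
coefficients of `b ^ k`. By Cauchy–Schwarz this is at most the square root of the size of the support
times the `ℓ²` norm, and the `ℓ²` norm is at most `sup_ℍ ‖b̃‖ ^ k`, by the mean value of
`‖b̃ ^ k‖ ^ 2` on the imaginary axis (`sum_norm_sq_le_of_forall_norm_le`). The size of the support of
`b ^ k` grows polynomially (`exists_support_pow`), so `k`-th roots give the inequality.

Thus `h` factors through a character of the closure `B` of the algebra of Dirichlet series in the
bounded continuous functions on `ℍ`. If `h a` is not in the closure of the values of the Dirichlet
series of `a`, then `f = a - h a` has a Dirichlet series that is bounded away from zero, and it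
suffices to show that it is invertible in `B` (`map_ne_zero_of_forall_le_norm`). Translating the
Dirichlet series of `f` to the right gives a path of bounded functions with the same lower bound,
from the nonzero constant term of `f`, its limit at infinity, to the Dirichlet series of `f`. Along
this path invertibility in `B` is an open condition and, since all inverses exist as bounded
functions, also a closed one (`Subalgebra.isUnit_apply_one_of_path`).
-/

namespace WeightFn.WeightedAlgebra

variable {M : Type*} [AddCommMonoid M] {w : WeightFn M}

/-! ### The weighted algebra as a Banach algebra -/

/-- Multiplication by the weight identifies the weighted algebra with the space `ℓ¹(M)`. -/
noncomputable def toLp (w : WeightFn M) : w.WeightedAlgebra ≃ₗ[ℂ] lp (fun _ : M => ℂ) 1 where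
  toFun a := ⟨fun x => a x * (w x : ℂ), memℓp_gen (by
    simpa [abs_of_pos (w.pos' _)] using a.summable)⟩
  map_add' a b := by
    ext x
    exact add_mul (a x) (b x) _
  map_smul' c a := by
    ext x
    exact mul_assoc c (a x) _
  invFun f := ⟨fun x => f x / (w x : ℂ), by
    have h := (memℓp_gen_iff (by simp)).1 (lp.memℓp f)
    refine h.congr fun x => ?_
    have := w.pos' x
    simp [abs_of_pos this, this.ne']⟩
  left_inv a := by
    ext x
    exact mul_div_cancel_right₀ (a x) (Complex.ofReal_ne_zero.2 (w.pos' x).ne')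
  right_inv f := by
    ext x
    exact div_mul_cancel₀ (f x) (Complex.ofReal_ne_zero.2 (w.pos' x).ne')

noncomputable instance : NormedAddCommGroup w.WeightedAlgebra :=
  NormedAddCommGroup.induced _ _ (toLp w) (toLp w).injective

theorem norm_def (a : w.WeightedAlgebra) : ‖a‖ = ∑' x, ‖a x‖ * w x := by
  change ‖toLp w a‖ = _
  rw [lp.norm_eq_tsum_rpow (by simp)]
  simp only [ENNReal.toReal_one, Real.rpow_one, div_one]
  refine tsum_congr fun x => ?_
  change ‖a x * (w x : ℂ)‖ = _
  rw [norm_mul, Complex.norm_real, Real.norm_of_nonneg (w.pos' x).le]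

instance : CompleteSpace w.WeightedAlgebra :=
  ((AddMonoidHomClass.isometry_of_norm (toLp w) fun _ => rfl).isUniformInducing.completeSpace_congr
    (toLp w).surjective).2 inferInstance

protected theorem norm_mul_le (a b : w.WeightedAlgebra) : ‖a * b‖ ≤ ‖a‖ * ‖b‖ := by
  -- Pairing `a * b` with the conjugate phases of its coefficients recovers its norm.
  let g : M → ℂ := fun z => (starRingEnd ℂ ((a * b) z) / ‖(a * b) z‖) * w z
  have hg : ∀ z, ‖g z‖ ≤ 1 * w z := by
    intro z
    simp only [g, norm_mul, norm_div, RCLike.norm_conj, Complex.norm_real, norm_norm,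
      Real.norm_of_nonneg (w.pos' z).le]
    exact mul_le_mul_of_nonneg_right (div_self_le_one _) (w.pos' z).le
  have h1 : ∀ z, (a * b) z * g z = ((‖(a * b) z‖ * w z : ℝ) : ℂ) := by
    intro z
    simp only [g]
    rw [← mul_assoc, ← mul_div_assoc, Complex.mul_conj, Complex.normSq_eq_norm_sq]
    by_cases h : (a * b) z = 0
    · simp [h]
    · have : (‖(a * b) z‖ : ℂ) ≠ 0 := by simpa using h
      push_cast
      field_simp
  have h2 : ((‖a * b‖ : ℝ) : ℂ) = ∑' p : M × M, a p.1 * b p.2 * g (p.1 + p.2) := by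
    rw [(summable_term a b hg).tsum_prod, ← tsum_mul_apply a b hg, norm_def, Complex.ofReal_tsum]
    exact tsum_congr fun z => (h1 z).symm
  have h3 : ‖((‖a * b‖ : ℝ) : ℂ)‖ ≤ 1 * (‖a‖ * ‖b‖) := by
    rw [h2, norm_def a, norm_def b, a.summable.tsum_mul_tsum b.summable (summable_majorant a b)]
    exact tsum_of_norm_bounded ((summable_majorant a b).hasSum.mul_left 1) (norm_term_le a b hg)
  simpa using h3

noncomputable instance : NormedCommRing w.WeightedAlgebra where
  __ := (inferInstance : CommRing w.WeightedAlgebra)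
  __ := (inferInstance : NormedAddCommGroup w.WeightedAlgebra)
  norm_mul_le := WeightFn.WeightedAlgebra.norm_mul_le

noncomputable instance : NormedAlgebra ℂ w.WeightedAlgebra where
  norm_smul_le c a := by
    rw [norm_def, norm_def, ← tsum_mul_left]
    exact le_of_eq (tsum_congr fun x => by rw [smul_apply, norm_mul, mul_assoc])

/-- The coefficient at `x`, as a continuous linear functional. -/
noncomputable def coeffCLM (w : WeightFn M) (x : M) : w.WeightedAlgebra →L[ℂ] ℂ :=
  LinearMap.mkContinuous ⟨⟨fun a => a x, fun _ _ => rfl⟩, fun _ _ => rfl⟩ (w x)⁻¹ fun a => by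
    rw [le_inv_mul_iff₀ (w.pos' x), mul_comm, norm_def]
    exact a.summable.le_tsum x fun y _ => mul_nonneg (norm_nonneg _) (w.pos' y).le

@[simp] theorem coeffCLM_apply (x : M) (a : w.WeightedAlgebra) : coeffCLM w x a = a x := rfl

open Classical in
/-- The basis element supported at `x`, with coefficient `1`. -/
noncomputable def single (w : WeightFn M) (x : M) : w.WeightedAlgebra :=
  ⟨Pi.single x 1, summable_of_ne_finset_zero (s := {x}) fun y hy => by
    rw [Finset.notMem_singleton] at hy
    simp [hy]⟩

open Classical in
theorem single_apply (x z : M) : single w x z = if z = x then 1 else 0 := by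
  change (Pi.single x 1 : M → ℂ) z = _
  simp [Pi.single_apply]

theorem norm_single (x : M) : ‖single w x‖ = w x := by
  rw [norm_def, tsum_eq_single x fun y hy => by simp [single_apply, hy]]
  simp [single_apply]

theorem single_zero : single w 0 = 1 := by
  ext z
  rw [single_apply, one_apply]

instance : NormOneClass w.WeightedAlgebra := ⟨by rw [← single_zero, norm_single, w.map_zero']⟩

theorem single_mul_single (x y : M) : single w x * single w y = single w (x + y) := by
  ext z
  rw [mul_apply_eq, tsum_eq_single x fun u hu => by simp [single_apply, hu],
    tsum_eq_single y fun u hu => by simp [single_apply, hu]]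
  by_cases h : x + y = z
  · simp [single_apply, h]
  · simp [single_apply, h, Ne.symm h]

theorem single_pow (x : M) (k : ℕ) : single w x ^ k = single w (k • x) := by
  induction k with
  | zero => rw [pow_zero, zero_smul, single_zero]
  | succ k ih => rw [pow_succ, ih, single_mul_single, succ_nsmul]

theorem hasSum_single (a : w.WeightedAlgebra) : HasSum (fun x => a x • single w x) a := by
  have hs : Summable fun x => a x • single w x := by
    refine Summable.of_norm ?_
    simpa only [norm_smul, norm_single] using a.summable
  convert hs.hasSum
  ext z
  rw [← coeffCLM_apply z (∑' x, a x • single w x), (coeffCLM w z).map_tsum hs,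
    tsum_eq_single z fun x hx => by simp [single_apply, hx.symm]]
  simp [single_apply]

/-- Since `w (k x) ^ (1 / k) → 1`, a character is bounded by `1` on the basis elements, whatever
the size of the weight. -/
theorem norm_algHom_single_le (hw : w.IsAdmissible) (h : w.WeightedAlgebra →ₐ[ℂ] ℂ) (x : M) :
    ‖h (single w x)‖ ≤ 1 := by
  refine ge_of_tendsto (hw.tendsto_root x) ((eventually_ge_atTop 1).mono fun k hk => ?_)
  have h1 : ‖h (single w x)‖ ^ k ≤ w (k • x) := by
    rw [← norm_pow, ← map_pow, single_pow, ← norm_single (w := w)]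
    exact AlgHom.norm_apply_le_self h _
  have h2 := Real.rpow_le_rpow (by positivity) h1 (z := 1 / (k : ℝ)) (by positivity)
  rwa [one_div, Real.pow_rpow_inv_natCast (norm_nonneg _) (by omega), ← one_div] at h2

/-! ### Finitely supported elements -/

theorem eq_sum_single {b : w.WeightedAlgebra} {s : Finset M} (hb : ∀ x ∉ s, b x = 0) :
    b = ∑ x ∈ s, b x • single w x := by
  refine (hasSum_single b).unique (hasSum_sum_of_ne_finset_zero fun x hx => ?_)
  rw [hb x hx, zero_smul]

theorem sum_single_apply_of_notMem (c : M → ℂ) {s : Finset M} {x : M} (hx : x ∉ s) :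
    (∑ y ∈ s, c y • single w y) x = 0 := by
  rw [← coeffCLM_apply x, map_sum]
  refine Finset.sum_eq_zero fun y hy => ?_
  have : x ≠ y := by rintro rfl; exact hx hy
  simp [single_apply, this]

theorem norm_algHom_le_sum (hw : w.IsAdmissible) (h : w.WeightedAlgebra →ₐ[ℂ] ℂ)
    {b : w.WeightedAlgebra} {s : Finset M} (hb : ∀ x ∉ s, b x = 0) :
    ‖h b‖ ≤ ∑ x ∈ s, ‖b x‖ := by
  conv_lhs => rw [eq_sum_single hb, map_sum]
  refine (norm_sum_le _ _).trans (Finset.sum_le_sum fun x _ => ?_)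
  rw [map_smul, norm_smul]
  exact mul_le_of_le_one_right (norm_nonneg _) (norm_algHom_single_le hw h x)

open Classical in
/-- The powers of a finitely supported element have supports of polynomial size: the exponents that
occur in `b ^ k` are the sums `∑ m x • x` with multiplicities `m x ≤ k`. -/
theorem exists_support_pow {b : w.WeightedAlgebra} {s : Finset M} (hb : ∀ x ∉ s, b x = 0) (k : ℕ) :
    ∃ t : Finset M, t.card ≤ (k + 1) ^ s.card ∧ ∀ x ∉ t, (b ^ k) x = 0 := by
  refine ⟨(Fintype.piFinset fun _ : s => Finset.range (k + 1)).image
    fun m => ∑ x : s, m x • (x : M), ?_, ?_⟩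
  · refine Finset.card_image_le.trans ?_
    simp
  induction k with
  | zero =>
    intro x hx
    rw [pow_zero, one_apply, if_neg]
    rintro rfl
    refine hx (Finset.mem_image.2 ⟨fun _ => 0, by simp, by simp⟩)
  | succ k ih =>
    intro z hz
    rw [pow_succ, mul_apply]
    convert tsum_zero with p
    by_contra hne
    obtain ⟨h1, h2⟩ := mul_ne_zero_iff.1 hne
    have h1' := not_imp_comm.1 (ih p.1.1) h1
    have h2' := not_imp_comm.1 (hb p.1.2) h2
    obtain ⟨m, hm, hm'⟩ := Finset.mem_image.1 h1'
    refine hz (Finset.mem_image.2 ⟨m + Pi.single ⟨p.1.2, h2'⟩ 1, ?_, ?_⟩)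
    · simp only [Fintype.mem_piFinset, Finset.mem_range] at hm ⊢
      intro x
      have := hm x
      have h3 : (Pi.single ⟨p.1.2, h2'⟩ 1 : s → ℕ) x ≤ 1 := by
        rw [Pi.single_apply]; split_ifs <;> simp
      simp only [Pi.add_apply]
      omega
    · refine Eq.trans ?_ p.2
      rw [← hm']
      simp [add_smul, Finset.sum_add_distrib, Pi.single_apply, ite_smul]

end WeightFn.WeightedAlgebra

/-! ### Mean values of trigonometric polynomials -/

theorem tendsto_mean_exp_mul_I (μ : ℝ) :
    Tendsto (fun T : ℝ => (T : ℂ)⁻¹ * ∫ t in (0 : ℝ)..T, Complex.exp (μ * Complex.I * t)) atTop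
      (𝓝 (if μ = 0 then 1 else 0)) := by
  split_ifs with hμ
  · refine tendsto_const_nhds.congr' ((eventually_gt_atTop 0).mono fun T hT => ?_)
    have : (T : ℂ) ≠ 0 := Complex.ofReal_ne_zero.2 hT.ne'
    simp [hμ, this]
  · have hc : (μ : ℂ) * Complex.I ≠ 0 := by simp [hμ]
    refine squeeze_zero_norm' (a := fun T : ℝ => T⁻¹ * (2 / |μ|))
      ((eventually_gt_atTop 0).mono fun T hT => ?_) ?_
    · rw [integral_exp_mul_complex hc, norm_mul, norm_inv, Complex.norm_real,
        Real.norm_of_nonneg hT.le, norm_div, norm_mul, Complex.norm_I, Complex.norm_real, mul_one,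
        Real.norm_eq_abs]
      gcongr
      refine (norm_sub_le _ _).trans ?_
      simp [Complex.norm_exp]
      norm_num
    · simpa using (tendsto_inv_atTop_zero (𝕜 := ℝ)).mul_const (2 / |μ|)

/-- Bessel's inequality for almost periodic polynomials. The mean of `‖∑ c x exp(i f x t)‖ ^ 2` over
`t` is the sum of the squares of the coefficients. -/
theorem sum_norm_sq_le_of_forall_norm_le {ι : Type*} (s : Finset ι) (c : ι → ℂ) {f : ι → ℝ}
    (hf : Function.Injective f) {K : ℝ}
    (hK : ∀ t : ℝ, ‖∑ x ∈ s, c x * Complex.exp (f x * Complex.I * t)‖ ≤ K) :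
    ∑ x ∈ s, ‖c x‖ ^ 2 ≤ K ^ 2 := by
  classical
  set F : ℝ → ℂ := fun t => ∑ x ∈ s, c x * Complex.exp (f x * Complex.I * t) with hF
  have hexp : ∀ t, F t * starRingEnd ℂ (F t) = ∑ x ∈ s, ∑ y ∈ s,
      c x * starRingEnd ℂ (c y) * Complex.exp (((f x - f y : ℝ) : ℂ) * Complex.I * t) := by
    intro t
    simp only [hF, map_sum, Finset.sum_mul_sum]
    refine Finset.sum_congr rfl fun x _ => Finset.sum_congr rfl fun y _ => ?_
    rw [map_mul, ← Complex.exp_conj, mul_mul_mul_comm, ← Complex.exp_add]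
    congr 2
    simp
    ring
  have hmean : Tendsto (fun T : ℝ => (T : ℂ)⁻¹ * ∫ t in (0 : ℝ)..T, F t * starRingEnd ℂ (F t)) atTop
      (𝓝 ((∑ x ∈ s, ‖c x‖ ^ 2 : ℝ) : ℂ)) := by
    have h1 : ∀ T : ℝ, (T : ℂ)⁻¹ * ∫ t in (0 : ℝ)..T, F t * starRingEnd ℂ (F t) =
        ∑ x ∈ s, ∑ y ∈ s, c x * starRingEnd ℂ (c y) * ((T : ℂ)⁻¹ *
          ∫ t in (0 : ℝ)..T, Complex.exp (((f x - f y : ℝ) : ℂ) * Complex.I * t)) := by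
      intro T
      simp only [hexp]
      rw [intervalIntegral.integral_finsetSum fun x _ =>
        Continuous.intervalIntegrable (by fun_prop) _ _, Finset.mul_sum]
      refine Finset.sum_congr rfl fun x _ => ?_
      rw [intervalIntegral.integral_finsetSum fun y _ =>
        Continuous.intervalIntegrable (by fun_prop) _ _, Finset.mul_sum]
      refine Finset.sum_congr rfl fun y _ => ?_
      rw [intervalIntegral.integral_const_mul]
      ring
    simp only [h1]
    have h2 : ((∑ x ∈ s, ‖c x‖ ^ 2 : ℝ) : ℂ) = ∑ x ∈ s, ∑ y ∈ s,
        c x * starRingEnd ℂ (c y) * (if f x - f y = 0 then 1 else 0) := by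
      push_cast
      refine Finset.sum_congr rfl fun x hx => ?_
      simp only [sub_eq_zero, hf.eq_iff]
      simp [hx, Complex.mul_conj, Complex.normSq_eq_norm_sq]
    rw [h2]
    exact tendsto_finsetSum _ fun x _ => tendsto_finsetSum _ fun y _ =>
      (tendsto_mean_exp_mul_I _).const_mul _
  have hle := le_of_tendsto hmean.norm ((eventually_gt_atTop 0).mono fun T hT => ?_) (b := K ^ 2)
  · rw [Complex.norm_real] at hle
    exact (le_abs_self _).trans hle
  · have h3 := intervalIntegral.norm_integral_le_of_norm_le_const (a := 0) (b := T) (C := K ^ 2)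
      (f := fun t => F t * starRingEnd ℂ (F t)) fun t _ => by
        rw [norm_mul, RCLike.norm_conj, ← sq]
        exact pow_le_pow_left₀ (norm_nonneg _) (hK t) 2
    rw [sub_zero, abs_of_pos hT] at h3
    rw [norm_mul, norm_inv, Complex.norm_real, Real.norm_of_nonneg hT.le, inv_mul_le_iff₀ hT,
      mul_comm T]
    exact h3

theorem le_of_forall_pow_le_mul_pow {x y : ℝ} (hy : 0 ≤ y) (n : ℕ)
    (h : ∀ k : ℕ, x ^ k ≤ (k + 1 : ℝ) ^ n * y ^ k) : x ≤ y := by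
  by_contra! hlt
  have hx0 : 0 < x := hy.trans_lt hlt
  set r := y / x
  have hr0 : 0 ≤ r := by positivity
  have hr1 : r < 1 := (div_lt_one hx0).2 hlt
  have h1 : ∀ k : ℕ, 1 ≤ (k + 1 : ℝ) ^ n * r ^ k := by
    intro k
    rw [div_pow, ← mul_div_assoc, one_le_div (by positivity)]
    exact h k
  have h2 : Tendsto (fun k : ℕ => ((k + 1 : ℕ) : ℝ) ^ n * r ^ (k + 1)) atTop (𝓝 0) :=
    (tendsto_add_atTop_iff_nat 1).2
      (tendsto_pow_const_mul_const_pow_of_abs_lt_one n (by rwa [abs_of_nonneg hr0]))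
  have h3 : r ≤ 0 := ge_of_tendsto' h2 fun k => by
    have := mul_le_mul_of_nonneg_right (h1 k) hr0
    push_cast
    rw [pow_succ]
    linarith
  have h4 := h1 1
  rw [le_antisymm h3 hr0] at h4
  norm_num at h4

/-! ### Dirichlet series as characters -/

namespace WeightFn.WeightedAlgebra

variable {Λ : AddSubmonoid ℝ} {w : WeightFn Λ}

theorem norm_exp_neg_mul_le_one (hΛ : ∀ x ∈ Λ, 0 ≤ x) {s : ℂ} (hs : 0 ≤ s.re) (l : Λ) :
    ‖Complex.exp (-((l : ℝ) : ℂ) * s)‖ ≤ 1 := by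
  rw [Complex.norm_exp, Real.exp_le_one_iff]
  simpa using mul_nonneg (hΛ l l.2) hs

theorem dirichletSeries_add (hΛ : ∀ x ∈ Λ, 0 ≤ x) (hw : w.IsAdmissible) (a b : w.WeightedAlgebra)
    {s : ℂ} (hs : 0 ≤ s.re) :
    dirichletSeries (a + b) s = dirichletSeries a s + dirichletSeries b s := by
  simp only [dirichletSeries]
  rw [← (summable_dirichletSeries hΛ hw a hs).of_norm.tsum_add
    (summable_dirichletSeries hΛ hw b hs).of_norm]
  exact tsum_congr fun l => add_mul (a l) (b l) _

theorem dirichletSeries_smul (c : ℂ) (a : w.WeightedAlgebra) (s : ℂ) :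
    dirichletSeries (c • a) s = c * dirichletSeries a s := by
  simp only [dirichletSeries]
  rw [← tsum_mul_left]
  exact tsum_congr fun l => mul_assoc c (a l) _

theorem dirichletSeries_eq_sum {b : w.WeightedAlgebra} {t : Finset Λ} (hb : ∀ x ∉ t, b x = 0)
    (s : ℂ) : dirichletSeries b s = ∑ x ∈ t, b x * Complex.exp (-((x : ℝ) : ℂ) * s) :=
  tsum_eq_sum fun x hx => by rw [hb x hx, zero_mul]

theorem dirichletSeries_one (s : ℂ) : dirichletSeries (1 : w.WeightedAlgebra) s = 1 := by
  rw [dirichletSeries_eq_sum (t := {0}) fun x hx => by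
    rw [one_apply, if_neg (Finset.notMem_singleton.1 hx)]]
  simp [one_apply]

theorem dirichletSeries_mul (hΛ : ∀ x ∈ Λ, 0 ≤ x) (hw : w.IsAdmissible) (a b : w.WeightedAlgebra)
    {s : ℂ} (hs : 0 ≤ s.re) :
    dirichletSeries (a * b) s = dirichletSeries a s * dirichletSeries b s := by
  simp only [dirichletSeries]
  rw [tsum_mul_apply a b (C := 1) fun x =>
    (norm_exp_neg_mul_le_one hΛ hs x).trans (by simpa using hw.one_le x), ← tsum_mul_right]
  refine tsum_congr fun x => ?_
  rw [← tsum_mul_left]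
  refine tsum_congr fun y => ?_
  rw [mul_mul_mul_comm, ← Complex.exp_add]
  congr 2
  push_cast
  ring

theorem norm_dirichletSeries_le (hΛ : ∀ x ∈ Λ, 0 ≤ x) (hw : w.IsAdmissible) (a : w.WeightedAlgebra)
    {s : ℂ} (hs : 0 ≤ s.re) : ‖dirichletSeries a s‖ ≤ ‖a‖ := by
  rw [norm_def]
  refine tsum_of_norm_bounded a.summable.hasSum fun l => ?_
  rw [norm_mul]
  exact mul_le_mul_of_nonneg_left ((norm_exp_neg_mul_le_one hΛ hs l).trans (hw.one_le l))
    (norm_nonneg _)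

theorem continuous_dirichletSeries (hΛ : ∀ x ∈ Λ, 0 ≤ x) (hw : w.IsAdmissible)
    (a : w.WeightedAlgebra) :
    Continuous fun s : rightHalfPlane => dirichletSeries a (s : ℂ) := by
  refine continuous_tsum (fun l => by fun_prop) a.summable fun l s => ?_
  rw [norm_mul]
  exact mul_le_mul_of_nonneg_left
    ((norm_exp_neg_mul_le_one hΛ (le_of_lt s.2) l).trans (hw.one_le l)) (norm_nonneg _)

open scoped BoundedContinuousFunction

/-- The homomorphism that sends an element of the weighted algebra to its Dirichlet series, a bounded
continuous function on the open right half plane. -/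
noncomputable def dirichletHom (hΛ : ∀ x ∈ Λ, 0 ≤ x) (hw : w.IsAdmissible) :
    w.WeightedAlgebra →ₐ[ℂ] (rightHalfPlane →ᵇ ℂ) :=
  AlgHom.ofLinearMap
    { toFun := fun a => BoundedContinuousFunction.ofNormedAddCommGroup
        (fun s : rightHalfPlane => dirichletSeries a (s : ℂ)) (continuous_dirichletSeries hΛ hw a)
        ‖a‖ fun s => norm_dirichletSeries_le hΛ hw a (le_of_lt s.2)
      map_add' := fun a b => by
        ext s
        exact dirichletSeries_add hΛ hw a b (le_of_lt s.2)
      map_smul' := fun c a => by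
        ext s
        exact dirichletSeries_smul c a s }
    (by ext s; exact dirichletSeries_one (w := w) s)
    (fun a b => by ext s; exact dirichletSeries_mul hΛ hw a b (le_of_lt s.2))

theorem dirichletHom_apply (hΛ : ∀ x ∈ Λ, 0 ≤ x) (hw : w.IsAdmissible) (a : w.WeightedAlgebra)
    (s : rightHalfPlane) : dirichletHom hΛ hw a s = dirichletSeries a (s : ℂ) := rfl

theorem norm_dirichletHom_le (hΛ : ∀ x ∈ Λ, 0 ≤ x) (hw : w.IsAdmissible) (a : w.WeightedAlgebra) :
    ‖dirichletHom hΛ hw a‖ ≤ ‖a‖ :=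
  (BoundedContinuousFunction.norm_le (norm_nonneg _)).2 fun s =>
    norm_dirichletSeries_le hΛ hw a (le_of_lt s.2)

theorem continuous_dirichletHom (hΛ : ∀ x ∈ Λ, 0 ≤ x) (hw : w.IsAdmissible) :
    Continuous (dirichletHom hΛ hw) :=
  AddMonoidHomClass.continuous_of_bound (dirichletHom hΛ hw) 1 fun a => by
    simpa using norm_dirichletHom_le hΛ hw a

/-! ### Characters are bounded by the supremum norm of the Dirichlet series -/

theorem sum_norm_sq_le (hΛ : ∀ x ∈ Λ, 0 ≤ x) (hw : w.IsAdmissible) {b : w.WeightedAlgebra}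
    {t : Finset Λ} (hb : ∀ x ∉ t, b x = 0) :
    ∑ x ∈ t, ‖b x‖ ^ 2 ≤ ‖dirichletHom hΛ hw b‖ ^ 2 := by
  refine sum_norm_sq_le_of_forall_norm_le t b (f := fun x : Λ => -(x : ℝ))
    (fun x y h => Subtype.ext (neg_injective h)) fun τ => ?_
  -- The bound on the open half plane passes to the imaginary axis by continuity.
  have hcl : IsClosed {s : ℂ | ‖∑ x ∈ t, b x * Complex.exp (-((x : ℝ) : ℂ) * s)‖ ≤
      ‖dirichletHom hΛ hw b‖} := isClosed_le (by fun_prop) continuous_const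
  have hsub : closure {s : ℂ | 0 < s.re} ⊆ _ := hcl.closure_subset_iff.2 fun s hs => by
    rw [Set.mem_ofPred_eq, ← dirichletSeries_eq_sum hb]
    exact (dirichletHom hΛ hw b).norm_coe_le_norm ⟨s, hs⟩
  rw [Complex.closure_setOfPred_lt_re] at hsub
  have := hsub (show (0 : ℝ) ≤ (Complex.I * τ).re by simp)
  simpa [mul_assoc] using this

/-- Bohr's inequality for finitely supported `b`. The powers `b ^ k` have supports of polynomial
size, so Cauchy–Schwarz and Bessel's inequality bound `‖h b‖ ^ k` by the `k`-th power of the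
supremum norm up to a factor of polynomial growth, which disappears in the `k`-th root. -/
theorem norm_algHom_le_of_finite_support (hΛ : ∀ x ∈ Λ, 0 ≤ x) (hw : w.IsAdmissible)
    (h : w.WeightedAlgebra →ₐ[ℂ] ℂ) {b : w.WeightedAlgebra} {t : Finset Λ}
    (hb : ∀ x ∉ t, b x = 0) : ‖h b‖ ≤ ‖dirichletHom hΛ hw b‖ := by
  have : Nonempty rightHalfPlane := ⟨⟨1, show 0 < (1 : ℂ).re by simp⟩⟩
  refine (pow_le_pow_iff_left₀ (norm_nonneg _) (norm_nonneg _) two_ne_zero).1 ?_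
  refine le_of_forall_pow_le_mul_pow (by positivity) t.card fun k => ?_
  obtain ⟨u, hu, hbu⟩ := exists_support_pow hb k
  calc (‖h b‖ ^ 2) ^ k = ‖h (b ^ k)‖ ^ 2 := by rw [map_pow, norm_pow, pow_right_comm]
    _ ≤ (∑ x ∈ u, ‖(b ^ k) x‖) ^ 2 := by gcongr; exact norm_algHom_le_sum hw h hbu
    _ ≤ u.card * ∑ x ∈ u, ‖(b ^ k) x‖ ^ 2 := sq_sum_le_card_mul_sum_sq
    _ ≤ (k + 1 : ℝ) ^ t.card * ‖dirichletHom hΛ hw (b ^ k)‖ ^ 2 := by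
        gcongr
        · exact_mod_cast hu
        · exact sum_norm_sq_le hΛ hw hbu
    _ ≤ (k + 1 : ℝ) ^ t.card * (‖dirichletHom hΛ hw b‖ ^ k) ^ 2 := by
        gcongr
        rw [map_pow]
        exact norm_pow_le _ _
    _ = _ := by rw [pow_right_comm]

theorem norm_algHom_le (hΛ : ∀ x ∈ Λ, 0 ≤ x) (hw : w.IsAdmissible)
    (h : w.WeightedAlgebra →ₐ[ℂ] ℂ) (b : w.WeightedAlgebra) : ‖h b‖ ≤ ‖dirichletHom hΛ hw b‖ := by
  have hh : Continuous h := map_continuous h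
  have hs : Tendsto (fun t : Finset Λ => ∑ x ∈ t, b x • single w x) atTop (𝓝 b) := hasSum_single b
  exact le_of_tendsto_of_tendsto' ((hh.tendsto b).comp hs).norm
    (((continuous_dirichletHom hΛ hw).tendsto b).comp hs).norm fun t =>
      norm_algHom_le_of_finite_support hΛ hw h (t := t) fun x hx => sum_single_apply_of_notMem b hx

end WeightFn.WeightedAlgebra

/-! ### Invertibility in the closure of the algebra of Dirichlet series -/

/-- A path in a closed subalgebra that is invertible in the ambient Banach algebra, and starts at a
unit of the subalgebra, stays in the units of the subalgebra. -/
theorem Subalgebra.isUnit_apply_one_of_path {A : Type*} [NormedRing A] [NormedAlgebra ℂ A]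
    [CompleteSpace A] (S : Subalgebra ℂ A) (hS : IsClosed (S : Set A)) {γ : unitInterval → S}
    (hγ : Continuous γ) (hunit : ∀ r, IsUnit (γ r : A)) (h0 : IsUnit (γ 0)) : IsUnit (γ 1) := by
  have : CompleteSpace S := hS.completeSpace_coe
  have hclopen : IsClopen {r | IsUnit (γ r)} := by
    refine ⟨isClosed_of_closure_subset fun r hr => ?_, Units.isOpen.preimage hγ⟩
    have hne : (𝓝[{r | IsUnit (γ r)}] r).NeBot := mem_closure_iff_nhdsWithin_neBot.1 hr
    exact Subalgebra.isUnit_of_isUnit_val_of_eventually S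
      (l := Filter.map γ (𝓝[{r | IsUnit (γ r)}] r))
      (hunit r) ((hγ.tendsto r).mono_left nhdsWithin_le_nhds)
      (eventually_map.2 eventually_mem_nhdsWithin) inferInstance
  exact (hclopen.eq_univ ⟨0, h0⟩ ▸ Set.mem_univ (1 : unitInterval) :)

open scoped BoundedContinuousFunction in
theorem BoundedContinuousFunction.isUnit_of_forall_le_norm {X : Type*} [TopologicalSpace X]
    {F : X →ᵇ ℂ} {ε : ℝ} (hε : 0 < ε) (hF : ∀ x, ε ≤ ‖F x‖) : IsUnit F := by
  have h0 : ∀ x, F x ≠ 0 := fun x => norm_pos_iff.1 (hε.trans_le (hF x))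
  refine IsUnit.of_mul_eq_one (BoundedContinuousFunction.ofNormedAddCommGroup (fun x => (F x)⁻¹)
    (F.continuous.inv₀ h0) ε⁻¹ fun x => ?_) ?_
  · rw [norm_inv]
    exact inv_anti₀ hε (hF x)
  · ext x
    exact mul_inv_cancel₀ (h0 x)

namespace WeightFn.WeightedAlgebra

variable {Λ : AddSubmonoid ℝ} {w : WeightFn Λ}

theorem norm_mul_rpow_le (hΛ : ∀ x ∈ Λ, 0 ≤ x) (z : ℂ) (x : Λ) (r : unitInterval) :
    ‖z * (((r : ℝ) ^ (x : ℝ) : ℝ) : ℂ)‖ ≤ ‖z‖ := by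
  rw [norm_mul, Complex.norm_real, Real.norm_of_nonneg (Real.rpow_nonneg r.2.1 _)]
  exact mul_le_of_le_one_right (norm_nonneg _) (Real.rpow_le_one r.2.1 r.2.2 (hΛ x x.2))

/-- The element with coefficients `f x * r ^ x`. Its Dirichlet series is that of `f`, translated to
the right by `-log r`; for `r = 0` only the constant term is left, as `0 ^ 0 = 1`. -/
noncomputable def damp (hΛ : ∀ x ∈ Λ, 0 ≤ x) (f : w.WeightedAlgebra) (r : unitInterval) :
    w.WeightedAlgebra :=
  ⟨fun x => f x * (((r : ℝ) ^ (x : ℝ) : ℝ) : ℂ),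
    f.summable.of_nonneg_of_le (fun x => mul_nonneg (norm_nonneg _) (w.pos' x).le) fun x =>
      mul_le_mul_of_nonneg_right (norm_mul_rpow_le hΛ (f x) x r) (w.pos' x).le⟩

theorem damp_apply (hΛ : ∀ x ∈ Λ, 0 ≤ x) (f : w.WeightedAlgebra) (r : unitInterval) (x : Λ) :
    damp hΛ f r x = f x * (((r : ℝ) ^ (x : ℝ) : ℝ) : ℂ) := rfl

theorem damp_one (hΛ : ∀ x ∈ Λ, 0 ≤ x) (f : w.WeightedAlgebra) : damp hΛ f 1 = f := by
  ext x
  simp [damp_apply]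

theorem damp_zero (hΛ : ∀ x ∈ Λ, 0 ≤ x) (f : w.WeightedAlgebra) :
    damp hΛ f 0 = algebraMap ℂ _ (f 0) := by
  ext x
  rw [Algebra.algebraMap_eq_smul_one, smul_apply, one_apply, damp_apply]
  by_cases hx : x = 0
  · simp [hx]
  · have : (x : ℝ) ≠ 0 := fun h => hx (Subtype.ext h)
    simp [hx, Real.zero_rpow this]

theorem continuous_damp (hΛ : ∀ x ∈ Λ, 0 ≤ x) (f : w.WeightedAlgebra) :
    Continuous (damp hΛ f) := by
  refine continuous_iff_continuousAt.2 fun r₀ => tendsto_iff_norm_sub_tendsto_zero.2 ?_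
  have hcont : Continuous fun r : unitInterval =>
      ∑' x : Λ, ‖damp hΛ f r x - damp hΛ f r₀ x‖ * w x := by
    refine continuous_tsum (fun x => ?_) (f.summable.mul_left 2) fun x r => ?_
    · have : Continuous fun r : unitInterval => (r : ℝ) ^ (x : ℝ) :=
        continuous_subtype_val.rpow_const fun r => Or.inr (hΛ x x.2)
      simp only [damp_apply]
      fun_prop
    · rw [norm_mul, norm_norm, Real.norm_of_nonneg (w.pos' x).le, ← mul_assoc]
      refine mul_le_mul_of_nonneg_right ((norm_sub_le _ _).trans ?_) (w.pos' x).le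
      rw [two_mul]
      exact add_le_add (norm_mul_rpow_le hΛ (f x) x r) (norm_mul_rpow_le hΛ (f x) x r₀)
  have h0 := hcont.tendsto r₀
  simp only [sub_self, norm_zero, zero_mul, tsum_zero] at h0
  refine h0.congr fun r => ?_
  rw [norm_def]
  rfl

theorem dirichletSeries_damp (hΛ : ∀ x ∈ Λ, 0 ≤ x) (f : w.WeightedAlgebra) {r : unitInterval}
    (hr : 0 < (r : ℝ)) (s : ℂ) :
    dirichletSeries (damp hΛ f r) s = dirichletSeries f (s - (Real.log r : ℝ)) := by
  refine tsum_congr fun x => ?_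
  rw [damp_apply, Real.rpow_def_of_pos hr, mul_assoc, Complex.ofReal_exp, ← Complex.exp_add]
  congr 2
  push_cast
  ring

theorem le_norm_dirichletSeries_damp (hΛ : ∀ x ∈ Λ, 0 ≤ x) (hw : w.IsAdmissible)
    {f : w.WeightedAlgebra} {ε : ℝ} (hf : ∀ s ∈ rightHalfPlane, ε ≤ ‖dirichletSeries f s‖)
    (r : unitInterval) {s : ℂ} (hs : s ∈ rightHalfPlane) :
    ε ≤ ‖dirichletSeries (damp hΛ f r) s‖ := by
  have hpos : ∀ r : unitInterval, 0 < r → ε ≤ ‖dirichletSeries (damp hΛ f r) s‖ := by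
    intro r hr
    rw [dirichletSeries_damp hΛ f (r := r) hr]
    refine hf _ ?_
    have h1 : Real.log r ≤ 0 := Real.log_nonpos r.2.1 r.2.2
    have h2 : 0 < s.re := hs
    change 0 < (s - (Real.log r : ℝ)).re
    rw [Complex.sub_re, Complex.ofReal_re]
    linarith
  rcases eq_or_lt_of_le (show 0 ≤ r from r.2.1) with h0 | h0
  · -- At `r = 0` the bound is the limit of the bounds for `r > 0`.
    subst h0
    have hc : Continuous fun r => ‖dirichletSeries (damp hΛ f r) s‖ :=
      (((BoundedContinuousFunction.evalCLM ℂ (⟨s, hs⟩ : rightHalfPlane)).continuous.comp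
        (continuous_dirichletHom hΛ hw)).comp (continuous_damp hΛ f)).norm
    have hcl : IsClosed {r | ε ≤ ‖dirichletSeries (damp hΛ f r) s‖} :=
      isClosed_le continuous_const hc
    have hsub : closure (Set.Ioi (0 : unitInterval)) ⊆ _ := hcl.closure_subset_iff.2 hpos
    rw [closure_Ioi' ⟨1, zero_lt_one⟩] at hsub
    exact hsub Set.self_mem_Ici
  · exact hpos r h0

/-- If the Dirichlet series of `f` is bounded away from zero, then no character vanishes at `f`. -/
theorem map_ne_zero_of_forall_le_norm (hΛ : ∀ x ∈ Λ, 0 ≤ x) (hw : w.IsAdmissible)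
    (h : w.WeightedAlgebra →ₐ[ℂ] ℂ) {f : w.WeightedAlgebra} {ε : ℝ} (hε : 0 < ε)
    (hf : ∀ s ∈ rightHalfPlane, ε ≤ ‖dirichletSeries f s‖) : h f ≠ 0 := by
  set D := dirichletHom hΛ hw with hD
  set S := D.range.topologicalClosure
  have hmem : ∀ b, D b ∈ S := fun b => Subalgebra.le_topologicalClosure _ ⟨b, rfl⟩
  have hDc : Continuous D := continuous_dirichletHom hΛ hw
  have h1 : IsUnit (⟨D (damp hΛ f 1), hmem _⟩ : S) := by
    refine S.isUnit_apply_one_of_path (Subalgebra.isClosed_topologicalClosure _)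
      (γ := fun r => ⟨D (damp hΛ f r), hmem _⟩)
      ((hDc.comp (continuous_damp hΛ f)).subtype_mk _) (fun r => ?_) ?_
    · exact BoundedContinuousFunction.isUnit_of_forall_le_norm hε fun s =>
        le_norm_dirichletSeries_damp hΛ hw hf r s.2
    · have h0 : f 0 ≠ 0 := by
        have hle := le_norm_dirichletSeries_damp hΛ hw hf 0 (s := 1)
          (show 0 < (1 : ℂ).re by simp)
        rw [damp_zero, Algebra.algebraMap_eq_smul_one, dirichletSeries_smul, dirichletSeries_one,
          mul_one] at hle
        exact norm_pos_iff.1 (hε.trans_le hle)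
      convert (isUnit_iff_ne_zero.2 h0).map (algebraMap ℂ S)
      rw [damp_zero, AlgHom.commutes]
      rfl
  obtain ⟨g, hg⟩ := h1.exists_right_inv
  have hg' : D f * (g : BoundedContinuousFunction rightHalfPlane ℂ) = 1 := by
    have := congrArg Subtype.val hg
    rwa [damp_one] at this
  -- A Dirichlet series `D q` so near the inverse of `D f` that `‖D (f * q - 1)‖ < 1`.
  have hgcl : (g : BoundedContinuousFunction rightHalfPlane ℂ) ∈ closure (Set.range D) := g.2
  have hopen : IsOpen {G | ‖D f * G - 1‖ < 1} :=
    isOpen_lt (by fun_prop) continuous_const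
  obtain ⟨_, hq, q, rfl⟩ := mem_closure_iff.1 hgcl _ hopen (by simp [hg'])
  intro hzero
  have hlt : ‖h (f * q - 1)‖ < 1 := (norm_algHom_le hΛ hw h _).trans_lt (by
    rw [← hD, map_sub, map_mul, map_one]
    exact hq)
  rw [map_sub, map_mul, hzero] at hlt
  simp at hlt

theorem exists_norm_dirichletSeries_sub_lt (hΛ : ∀ x ∈ Λ, 0 ≤ x) (hw : w.IsAdmissible)
    (a : w.WeightedAlgebra) (h : w.WeightedAlgebra →ₐ[ℂ] ℂ) {ε : ℝ} (hε : 0 < ε) :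
    ∃ s ∈ rightHalfPlane, ‖dirichletSeries a s - h a‖ < ε := by
  by_contra! hcon
  refine map_ne_zero_of_forall_le_norm hΛ hw h (f := a - algebraMap ℂ _ (h a)) hε
    (fun s hs => ?_) (by simp)
  refine (hcon s hs).trans_eq ?_
  have := DFunLike.congr_fun (map_sub (dirichletHom hΛ hw) a (algebraMap ℂ _ (h a))) ⟨s, hs⟩
  rw [AlgHom.commutes] at this
  rw [dirichletHom_apply] at this
  rw [this]
  simp [dirichletHom_apply]

end WeightFn.WeightedAlgebra

/-! ### Density of the values in the spectrum -/

open WeightFn.WeightedAlgebra in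
theorem mainTheorem2 (Λ : AddSubmonoid ℝ) (hΛ : ∀ x ∈ Λ, 0 ≤ x)
    (w : WeightFn Λ) (hw : w.IsAdmissible) (a : w.WeightedAlgebra) :
    (dirichletSeries a '' rightHalfPlane ⊆ spectrum ℂ a ∧
      spectrum ℂ a ⊆ closure (dirichletSeries a '' rightHalfPlane)) ∧
    (∀ h : w.WeightedAlgebra →ₐ[ℂ] ℂ, ∀ ε : ℝ, 0 < ε →
      ∃ s ∈ rightHalfPlane, ‖dirichletSeries a s - h a‖ < ε) := by
  refine ⟨⟨?_, fun z hz => ?_⟩, fun h ε hε => exists_norm_dirichletSeries_sub_lt hΛ hw a h hε⟩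
  · rintro _ ⟨s, hs, rfl⟩
    refine AlgHom.spectrum_apply_subset (dirichletHom hΛ hw) a (spectrum.mem_iff.2 fun hu => ?_)
    obtain ⟨g, hg⟩ := hu.exists_right_inv
    have := DFunLike.congr_fun hg ⟨s, hs⟩
    simp [dirichletHom_apply] at this
  · obtain ⟨φ, rfl⟩ := WeakDual.CharacterSpace.mem_spectrum_iff_exists.1 hz
    refine Metric.mem_closure_iff.2 fun ε hε => ?_
    obtain ⟨s, hs, hlt⟩ := exists_norm_dirichletSeries_sub_lt hΛ hw a
      (WeakDual.CharacterSpace.toAlgHom φ) hε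
    exact ⟨_, ⟨s, hs, rfl⟩, by rw [dist_comm, dist_eq_norm]; exact hlt⟩
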